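/- Let $K$ be a real quadratic field. Let $\mathscr{F}(K)$ be the set of isomorphism classes of quartic number fields $L$ which have exactly two real places and one complex place, whose Galois closure over $\mathbb{Q}$ has Galois group isomorphic to the dihedral group $D_4$ of order $8$, and which contain a subfield isomorphic to $K$. For such $L$, the group of units of $\mathcal{O}_L$ modulo torsion embeds into Euclidean space $\mathbb{R}^3$ by $u \mapsto (\log|\sigma_1(u)|, \log|\sigma_2(u)|, 2\log|\tau(u)|)$, where $\sigma_1,\sigma_2$ are the real embeddings of $L$ and $\tau$ is one of the complex embeddings. Its image is a rank two lattice; let $p_L \in \mathrm{GL}_2(\mathbb{Z})\backslash\mathfrak{h}$ be the class of this lattice up to homothety and isometry, that is, the class of any $\tau$ in the upper half plane $\mathfrak{h}$ such that the lattice is similar to $\mathbb{Z}+\mathbb{Z}\tau \subset \mathbb{C}$. Let $\operatorname{Im} p_L$ be the imaginary part of the unique representative of $p_L$ in the fundamental domain $\{x+iy : 0\le x\le \tfrac12,\ y>0,\ x^2+y^2\ge 1\}$. Let $\operatorname{Disc}(L/K)$ be the relative discriminant ideal, i.e. the relative norm of the different of $L/K$. Then: 1. The set $\{p_L : L \in \mathscr{F}(K)\}$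 has no limit points in $\mathrm{GL}_2(\mathbb{Z})\backslash\mathfrak{h}$, where a limit point of a set $S$ is a point each of whose neighbourhoods contains a point of $S$ different from it. 2. There is a constant $c_K>0$, depending only on $K$, such that for every $L \in \mathscr{F}(K)$ and every embedding $K \hookrightarrow L$, $$\operatorname{Im} p_L \;\ge\; c_K\sqrt{\log \bigl|N_{K/\mathbb{Q}}(\operatorname{Disc}(L/K))\bigr|}.$$ 3. The right-hand side tends to infinity over $\mathscr{F}(K)$: for every real number $B$ there are only finitely many $L \in \mathscr{F}(K)$ with $\sqrt{\log |N_{K/\mathbb{Q}}(\operatorname{Disc}(L/K))|} \le B$ for some embedding $K\hookrightarrow L$. -/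

import Mathlib

open NumberField NumberField.InfinitePlace NumberField.Units
open scoped UpperHalfPlane

universe u v

set_option maxSynthPendingDepth 3

noncomputable section

namespace UnitShape

/-! ### The moduli space of rank two lattices -/

/-- The image of `GL₂(ℤ)` in `GL₂(ℝ)`. It acts on `ℍ` through Mathlib's action of `GL₂(ℝ)`:
`(aτ + b) / (cτ + d)` if the determinant is positive, and the complex conjugate of this if the
determinant is negative. -/
def GL2Z : Subgroup (GL (Fin 2) ℝ) :=
  (Matrix.GeneralLinearGroup.map (n := Fin 2) (Int.castRingHom ℝ)).range

/-- The space `GL₂(ℤ) \ ℍ` of rank two lattices up to homothety and reflection, with the quotient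
topology. -/
abbrev ShapeSpace : Type := Quotient (MulAction.orbitRel GL2Z ℍ)

/-- The class in `GL₂(ℤ) \ ℍ` of a point of the upper half plane. -/
def toShape (τ : ℍ) : ShapeSpace := Quotient.mk _ τ

theorem toShape_eq_iff {τ τ' : ℍ} :
    toShape τ' = toShape τ ↔
      ∃ g : GL (Fin 2) ℤ,
        Matrix.GeneralLinearGroup.map (n := Fin 2) (Int.castRingHom ℝ) g • τ = τ' := by
  unfold toShape
  rw [Quotient.eq, MulAction.orbitRel_apply, MulAction.mem_orbit_iff]
  constructor
  · rintro ⟨⟨_, g, rfl⟩, h⟩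
    exact ⟨g, h⟩
  · rintro ⟨g, h⟩
    exact ⟨⟨_, g, rfl⟩, h⟩

/-- The equivalence relation in real coordinates. -/
theorem toShape_eq_iff_int {τ τ' : ℍ} :
    toShape τ' = toShape τ ↔
      ∃ a b c d : ℤ, (a * d - b * c) ^ 2 = 1 ∧
        τ'.re * ((c * τ.re + d) ^ 2 + (c * τ.im) ^ 2) =
          (a * τ.re + b) * (c * τ.re + d) + a * c * τ.im ^ 2 ∧
        τ'.im * ((c * τ.re + d) ^ 2 + (c * τ.im) ^ 2) = τ.im := by
  have key : ∀ g : GL (Fin 2) ℤ, (g 0 0 * g 1 1 - g 0 1 * g 1 0) ^ 2 = 1 →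
      (Matrix.GeneralLinearGroup.map (n := Fin 2) (Int.castRingHom ℝ) g • τ = τ' ↔
        τ'.re * ((g 1 0 * τ.re + g 1 1) ^ 2 + (g 1 0 * τ.im) ^ 2) =
          (g 0 0 * τ.re + g 0 1) * (g 1 0 * τ.re + g 1 1) + g 0 0 * g 1 0 * τ.im ^ 2 ∧
        τ'.im * ((g 1 0 * τ.re + g 1 1) ^ 2 + (g 1 0 * τ.im) ^ 2) = τ.im) := by
    intro g hg
    set G := Matrix.GeneralLinearGroup.map (n := Fin 2) (Int.castRingHom ℝ) g with hG
    have hN : Complex.normSq (UpperHalfPlane.denom G τ) =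
        (g 1 0 * τ.re + g 1 1) ^ 2 + (g 1 0 * τ.im) ^ 2 := by
      simp [hG, UpperHalfPlane.denom, Complex.normSq_apply]
      ring
    have hNpos := UpperHalfPlane.normSq_denom_pos G (z := τ) τ.im_ne_zero
    have hdet : |G.det.val| = 1 := by
      have h1 : G.det.val = ((g 0 0 * g 1 1 - g 0 1 * g 1 0 : ℤ) : ℝ) := by
        simp [hG, Matrix.det_fin_two]
      rw [h1, ← Int.cast_abs]
      rcases sq_eq_one_iff.mp hg with h | h <;> simp [h]
    have him : (G • τ).im = τ.im / Complex.normSq (UpperHalfPlane.denom G τ) := by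
      rw [UpperHalfPlane.im_smul_eq_div_normSq, hdet, one_mul]
    have hre : (G • τ).re =
        ((g 0 0 * τ.re + g 0 1) * (g 1 0 * τ.re + g 1 1) + g 0 0 * g 1 0 * τ.im ^ 2) /
          Complex.normSq (UpperHalfPlane.denom G τ) := by
      rw [UpperHalfPlane.re_smul, Complex.div_re, ← add_div]
      congr 1
      simp [hG, UpperHalfPlane.denom, UpperHalfPlane.num]
      ring
    rw [← hN]
    constructor
    · intro h
      rw [← h, hre, him]
      constructor <;> field_simp
    · rintro ⟨h1, h2⟩
      apply UpperHalfPlane.ext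
      apply Complex.ext
      · rw [UpperHalfPlane.coe_re, UpperHalfPlane.coe_re, hre, ← h1]
        field_simp
      · rw [UpperHalfPlane.coe_im, UpperHalfPlane.coe_im, him, ← h2]
        field_simp
  rw [toShape_eq_iff]
  constructor
  · rintro ⟨g, hg⟩
    have hdet : (g 0 0 * g 1 1 - g 0 1 * g 1 0) ^ 2 = 1 := by
      have h := g.det.isUnit
      rw [Int.isUnit_iff, Matrix.GeneralLinearGroup.val_det_apply, Matrix.det_fin_two] at h
      rcases h with h | h <;> simp [h]
    exact ⟨_, _, _, _, hdet, (key g hdet).mp hg⟩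
  · rintro ⟨a, b, c, d, h, h'⟩
    have hu : IsUnit (!![a, b; c, d] : Matrix (Fin 2) (Fin 2) ℤ).det := by
      rw [Matrix.det_fin_two_of, Int.isUnit_iff]
      exact sq_eq_one_iff.mp h
    refine ⟨Matrix.nonsingInvUnit _ hu, (key _ ?_).mpr ?_⟩
    · exact h
    · exact h'

/-- The standard fundamental domain `{x + iy : 0 ≤ x ≤ 1/2, x² + y² ≥ 1, y > 0}` of
`GL₂(ℤ) \ ℍ`. -/
def fundamentalDomain : Set ℍ :=
  {τ | 0 ≤ τ.re ∧ τ.re ≤ 1 / 2 ∧ 1 ≤ τ.re ^ 2 + τ.im ^ 2}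

theorem exists_mem_fundamentalDomain (p : ShapeSpace) :
    ∃ τ ∈ fundamentalDomain, toShape τ = p := by
  obtain ⟨z, rfl⟩ := Quotient.exists_rep p
  obtain ⟨g, hg1, hg2⟩ := ModularGroup.exists_smul_mem_fd z
  have key : toShape (g • z) = toShape z := by
    rw [toShape_eq_iff]
    refine ⟨(g : GL (Fin 2) ℤ), ?_⟩
    rw [UpperHalfPlane.SLAction, MulAction.compHom_smul_def]
    rfl
  rw [Complex.normSq_apply] at hg1
  simp only [UpperHalfPlane.coe_re, UpperHalfPlane.coe_im] at hg1
  rw [abs_le] at hg2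
  rcases le_total 0 (g • z).re with h | h
  · exact ⟨g • z, ⟨h, hg2.2, by nlinarith⟩, key⟩
  · have hJ : (UpperHalfPlane.J • (g • z)).re = -(g • z).re := by
      rw [← UpperHalfPlane.coe_re, UpperHalfPlane.coe_J_smul]
      simp
    have hJ' : (UpperHalfPlane.J • (g • z)).im = (g • z).im := by
      rw [← UpperHalfPlane.coe_im, UpperHalfPlane.coe_J_smul]
      simp
    refine ⟨UpperHalfPlane.J • (g • z), ⟨by linarith, by linarith, by rw [hJ, hJ']; nlinarith⟩,
      Eq.trans ?_ key⟩
    rw [toShape_eq_iff_int]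
    exact ⟨-1, 0, 0, 1, by norm_num, by rw [hJ]; push_cast; ring, by rw [hJ']; push_cast; ring⟩

/-- A lower bound for the denominators `|cτ + d|²` on the fundamental domain. -/
theorem one_le_denom {τ : ℍ} (hτ : τ ∈ fundamentalDomain) {c d : ℤ} (h : c ≠ 0 ∨ d ≠ 0) :
    1 ≤ (c * τ.re + d) ^ 2 + (c * τ.im) ^ 2 ∧
      (c ≠ 0 → (c * τ.re + d) ^ 2 + (c * τ.im) ^ 2 = 1 → τ.re ^ 2 + τ.im ^ 2 = 1) := by
  obtain ⟨h0, h1, h2⟩ := hτ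
  have hint : (1 : ℤ) ≤ c ^ 2 - |c * d| + d ^ 2 := by
    have hpos : 0 < c ^ 2 - |c * d| + d ^ 2 := by
      rw [abs_mul, ← sq_abs c, ← sq_abs d]
      rcases h with h | h
      · have := abs_pos.mpr h
        nlinarith [sq_nonneg (|c| - 2 * |d|)]
      · have := abs_pos.mpr h
        nlinarith [sq_nonneg (2 * |c| - |d|)]
    omega
  have hreal : (1 : ℝ) ≤ c ^ 2 - |(c * d : ℝ)| + d ^ 2 := by exact_mod_cast hint
  have hcd : -|(c * d : ℝ)| ≤ 2 * (c * d) * τ.re := by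
    have h3 : |2 * (c * d : ℝ) * τ.re| ≤ |(c * d : ℝ)| := by
      rw [abs_mul, abs_mul, abs_two, abs_of_nonneg h0]
      nlinarith [abs_nonneg (c * d : ℝ)]
    linarith [neg_abs_le (2 * (c * d : ℝ) * τ.re)]
  have hexp : (c * τ.re + d) ^ 2 + (c * τ.im) ^ 2 =
      (c : ℝ) ^ 2 * (τ.re ^ 2 + τ.im ^ 2 - 1) + (c ^ 2 + 2 * (c * d) * τ.re + d ^ 2) := by ring
  have hnn : 0 ≤ (c : ℝ) ^ 2 * (τ.re ^ 2 + τ.im ^ 2 - 1) :=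
    mul_nonneg (sq_nonneg _) (by linarith)
  refine ⟨by linarith, fun hc he => ?_⟩
  have hz : (c : ℝ) ^ 2 * (τ.re ^ 2 + τ.im ^ 2 - 1) = 0 := by linarith
  have hc' : (c : ℝ) ^ 2 ≠ 0 := pow_ne_zero _ (by exact_mod_cast hc)
  have := (mul_eq_zero.mp hz).resolve_left hc'
  linarith

/-- Every class contains exactly one point of the fundamental domain. -/
theorem existsUnique_mem_fundamentalDomain (p : ShapeSpace) :
    ∃! τ : ℍ, τ ∈ fundamentalDomain ∧ toShape τ = p := by
  obtain ⟨τ, hτ, rfl⟩ := exists_mem_fundamentalDomain p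
  have im_le : ∀ {z w : ℍ}, z ∈ fundamentalDomain → toShape w = toShape z → w.im ≤ z.im ∧
      (w.im = z.im → (z.re ^ 2 + z.im ^ 2 = 1 ∨
        ∃ e b : ℤ, (e = 1 ∨ e = -1) ∧ w.re = e * z.re + b)) := by
    intro z w hz hwz
    obtain ⟨a, b, c, d, hdet, hre, him⟩ := toShape_eq_iff_int.mp hwz
    have hne : c ≠ 0 ∨ d ≠ 0 := by
      by_contra! hcon
      simp [hcon.1, hcon.2] at hdet
    obtain ⟨hge, heq⟩ := one_le_denom hz hne
    refine ⟨by nlinarith [w.im_pos], fun h => ?_⟩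
    have hN : ((c : ℝ) * z.re + d) ^ 2 + (c * z.im) ^ 2 = 1 := by
      rw [h] at him
      exact mul_left_cancel₀ z.im_ne_zero (by rw [him, mul_one])
    by_cases hc : c = 0
    · right
      subst hc
      have hd : d = 1 ∨ d = -1 := by
        apply sq_eq_one_iff.mp
        have : (d : ℝ) ^ 2 = 1 := by simpa using hN
        exact_mod_cast this
      have ha : a = 1 ∨ a = -1 := by
        apply sq_eq_one_iff.mp
        rcases hd with rfl | rfl <;> simpa using hdet
      rw [hN] at hre
      refine ⟨a * d, b * d, ?_, ?_⟩
      · rcases hd with rfl | rfl <;> rcases ha with rfl | rfl <;> simp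
      · push_cast at hre ⊢
        linarith
    · exact Or.inl (heq hc hN)
  refine ⟨τ, ⟨hτ, rfl⟩, ?_⟩
  rintro w ⟨hw, hwτ⟩
  have h1 := im_le hτ hwτ
  have h2 := im_le hw hwτ.symm
  have him : w.im = τ.im := le_antisymm h1.1 h2.1
  obtain ⟨t0, t1, t2⟩ := hτ
  obtain ⟨w0, w1, w2⟩ := hw
  have aux : ∀ {x y : ℝ} {e b : ℤ}, 0 ≤ x → x ≤ 1 / 2 → 0 ≤ y → y ≤ 1 / 2 → (e = 1 ∨ e = -1) →
      y = e * x + b → y = x := by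
    intro x y e b hx0 hx1 hy0 hy1 he h
    rcases he with rfl | rfl
    · have hb1 : (b : ℝ) < 1 := by push_cast at h; linarith
      have hb2 : (-1 : ℝ) < b := by push_cast at h; linarith
      have hb : b = 0 := by
        have h1 : b < 1 := by exact_mod_cast hb1
        have h2 : -1 < b := by exact_mod_cast hb2
        omega
      subst hb
      simpa using h
    · have hb1 : (b : ℝ) ≤ 1 := by push_cast at h; linarith
      have hb2 : (0 : ℝ) ≤ b := by push_cast at h; linarith
      have hb : b = 0 ∨ b = 1 := by
        have h1 : b ≤ 1 := by exact_mod_cast hb1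
        have h2 : 0 ≤ b := by exact_mod_cast hb2
        omega
      rcases hb with rfl | rfl <;> push_cast at h <;> linarith
  have hre : w.re = τ.re := by
    rcases h1.2 him with h | ⟨e, b, he, h⟩
    · rcases h2.2 him.symm with h' | ⟨e, b, he, h'⟩
      · have : w.re ^ 2 = τ.re ^ 2 := by rw [him] at h'; linarith
        exact (sq_eq_sq₀ w0 t0).mp this
      · exact (aux w0 w1 t0 t1 he h').symm
    · exact aux t0 t1 w0 w1 he h
  exact UpperHalfPlane.ext (Complex.ext hre him)

/-- The representative of a class in the fundamental domain, through which `GL₂(ℤ) \ ℍ` is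
identified with the fundamental domain. -/
def representative (p : ShapeSpace) : ℍ := (existsUnique_mem_fundamentalDomain p).choose

theorem representative_mem (p : ShapeSpace) : representative p ∈ fundamentalDomain :=
  (existsUnique_mem_fundamentalDomain p).choose_spec.1.1

theorem toShape_representative (p : ShapeSpace) : toShape (representative p) = p :=
  (existsUnique_mem_fundamentalDomain p).choose_spec.1.2

theorem representative_eq {p : ShapeSpace} {τ : ℍ} (hτ : τ ∈ fundamentalDomain)
    (h : toShape τ = p) : representative p = τ :=
  ((existsUnique_mem_fundamentalDomain p).choose_spec.2 τ ⟨hτ, h⟩).symm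

/-! ### The shape of a rank two lattice -/

section Lattice

variable {E : Type*} [NormedAddCommGroup E] [InnerProductSpace ℝ E]

theorem gram_pos {u v : E} (h : LinearIndependent ℝ ![u, v]) :
    0 < ‖u‖ ^ 2 * ‖v‖ ^ 2 - inner ℝ u v ^ 2 := by
  have hu : u ≠ 0 := h.ne_zero 0
  have h1 : |inner ℝ u v| < ‖u‖ * ‖v‖ := by
    refine lt_of_le_of_ne (abs_real_inner_le_norm u v) fun he => ?_
    have h2 := (norm_inner_eq_norm_tfae ℝ u v).out 0 1
    rcases h2.mp (by simpa using he) with h3 | h3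
    · exact hu h3
    · rw [LinearIndependent.pair_iff] at h
      have h4 := h (inner ℝ u v / inner ℝ u u) (-1) (by rw [← h3]; simp)
      simp at h4
  have h2 : inner ℝ u v ^ 2 < (‖u‖ * ‖v‖) ^ 2 := by
    rw [← sq_abs]
    exact pow_lt_pow_left₀ h1 (abs_nonneg _) two_ne_zero
  nlinarith

/-- The point `τ` of the upper half plane such that `u ↦ 1`, `v ↦ τ` is a similarity from the
real span of `u, v` to `ℂ`; see `norm_smul_add_smul`. -/
def latticePoint (u v : E) (h : LinearIndependent ℝ ![u, v]) : ℍ :=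
  ⟨⟨inner ℝ u v / ‖u‖ ^ 2, √(‖u‖ ^ 2 * ‖v‖ ^ 2 - inner ℝ u v ^ 2) / ‖u‖ ^ 2⟩, by
    have hu : u ≠ 0 := h.ne_zero 0
    exact div_pos (Real.sqrt_pos.mpr (gram_pos h)) (pow_pos (norm_pos_iff.mpr hu) 2)⟩

theorem latticePoint_re (u v : E) (h : LinearIndependent ℝ ![u, v]) :
    (latticePoint u v h).re = inner ℝ u v / ‖u‖ ^ 2 := rfl

theorem latticePoint_im (u v : E) (h : LinearIndependent ℝ ![u, v]) :
    (latticePoint u v h).im = √(‖u‖ ^ 2 * ‖v‖ ^ 2 - inner ℝ u v ^ 2) / ‖u‖ ^ 2 := rfl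

theorem norm_sq_smul_add_smul (u v : E) (h : LinearIndependent ℝ ![u, v]) (x y : ℝ) :
    ‖x • u + y • v‖ ^ 2 = ‖u‖ ^ 2 *
      ((x + y * (latticePoint u v h).re) ^ 2 + (y * (latticePoint u v h).im) ^ 2) := by
  have hu : ‖u‖ ≠ 0 := norm_ne_zero_iff.mpr (h.ne_zero 0)
  have hs := Real.sq_sqrt (gram_pos h).le
  rw [latticePoint_re, latticePoint_im, mul_pow y, div_pow, hs, norm_add_sq_real, norm_smul,
    norm_smul, real_inner_smul_left, real_inner_smul_right, mul_pow, mul_pow, Real.norm_eq_abs,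
    Real.norm_eq_abs, sq_abs, sq_abs]
  field_simp
  ring

/-- The map `x u + y v ↦ x + y τ` is a similarity. -/
theorem norm_smul_add_smul (u v : E) (h : LinearIndependent ℝ ![u, v]) (x y : ℝ) :
    ‖x • u + y • v‖ = ‖u‖ * ‖(x + y * (latticePoint u v h : ℂ) : ℂ)‖ := by
  have h1 := norm_sq_smul_add_smul u v h x y
  have h2 : ‖(x + y * (latticePoint u v h : ℂ) : ℂ)‖ ^ 2 =
      (x + y * (latticePoint u v h).re) ^ 2 + (y * (latticePoint u v h).im) ^ 2 := by
    rw [← Complex.normSq_eq_norm_sq, Complex.normSq_apply]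
    simp
    ring
  rw [← h2, ← mul_pow] at h1
  exact (sq_eq_sq₀ (norm_nonneg _) (by positivity)).mp h1

/-- The class of the lattice point does not depend on the choice of a `ℤ`-basis. -/
theorem toShape_latticePoint_eq {u v u' v' : E} (h : LinearIndependent ℝ ![u, v])
    (h' : LinearIndependent ℝ ![u', v']) (a b c d : ℤ) (hdet : (a * d - b * c) ^ 2 = 1)
    (hv' : v' = (a : ℝ) • v + (b : ℝ) • u) (hu' : u' = (c : ℝ) • v + (d : ℝ) • u) :
    toShape (latticePoint u' v' h') = toShape (latticePoint u v h) := by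
  rw [toShape_eq_iff_int]
  refine ⟨a, b, c, d, hdet, ?_⟩
  have hu : ‖u‖ ≠ 0 := norm_ne_zero_iff.mpr (h.ne_zero 0)
  have hu0 : ‖u'‖ ≠ 0 := norm_ne_zero_iff.mpr (h'.ne_zero 0)
  have hN := norm_sq_smul_add_smul u v h d c
  rw [add_comm, ← hu'] at hN
  have hN' : (c * (latticePoint u v h).re + d) ^ 2 + (c * (latticePoint u v h).im) ^ 2 =
      ‖u'‖ ^ 2 / ‖u‖ ^ 2 := by
    rw [hN]
    field_simp
    ring
  have hs := Real.sq_sqrt (gram_pos h).le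
  have hinner : inner ℝ u' v' = a * c * ‖v‖ ^ 2 + (a * d + b * c) * inner ℝ u v
      + b * d * ‖u‖ ^ 2 := by
    rw [hu', hv']
    simp only [inner_add_left, inner_add_right, real_inner_smul_left, real_inner_smul_right,
      real_inner_comm u v]
    simp only [real_inner_self_eq_norm_sq]
    ring
  have hnu : ‖u'‖ ^ 2 = c ^ 2 * ‖v‖ ^ 2 + 2 * c * d * inner ℝ u v + d ^ 2 * ‖u‖ ^ 2 := by
    rw [← real_inner_self_eq_norm_sq u', hu']
    simp only [inner_add_left, inner_add_right, real_inner_smul_left, real_inner_smul_right,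
      real_inner_comm u v]
    simp only [real_inner_self_eq_norm_sq]
    ring
  have hnv : ‖v'‖ ^ 2 = a ^ 2 * ‖v‖ ^ 2 + 2 * a * b * inner ℝ u v + b ^ 2 * ‖u‖ ^ 2 := by
    rw [← real_inner_self_eq_norm_sq v', hv']
    simp only [inner_add_left, inner_add_right, real_inner_smul_left, real_inner_smul_right,
      real_inner_comm u v]
    simp only [real_inner_self_eq_norm_sq]
    ring
  have hgram : ‖u'‖ ^ 2 * ‖v'‖ ^ 2 - inner ℝ u' v' ^ 2 =
      ‖u‖ ^ 2 * ‖v‖ ^ 2 - inner ℝ u v ^ 2 := by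
    have hdet' : ((a : ℝ) * d - b * c) ^ 2 = 1 := by exact_mod_cast hdet
    rw [hinner, hnu, hnv]
    linear_combination (‖u‖ ^ 2 * ‖v‖ ^ 2 - inner ℝ u v ^ 2) * hdet'
  rw [hN', latticePoint_re, latticePoint_im, latticePoint_re, latticePoint_im, hgram]
  refine ⟨?_, by field_simp⟩
  rw [div_pow √_, hs, hinner]
  field_simp
  ring

end Lattice

/-! ### The unit lattice of a number field and its shape -/

section Units

variable (L : Type*) [Field L] [NumberField L]

/-- The logarithmic map on units, with values in Euclidean space, whose coordinates are
`log |σ(u)|` at the real places and `2 log |τ(u)|` at the complex places. -/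
def unitLog : Additive (𝓞 L)ˣ →+ EuclideanSpace ℝ (InfinitePlace L) where
  toFun x := WithLp.toLp 2 fun w => (mult w : ℝ) * Real.log (w ((x.toMul : (𝓞 L)ˣ) : L))
  map_zero' := by ext; simp
  map_add' x y := by ext; simp [Real.log_mul, mul_add]

theorem unitLog_eq_zero_of_mem_torsion {x : (𝓞 L)ˣ} (hx : x ∈ torsion L) :
    unitLog L (Additive.ofMul x) = 0 := by
  rw [mem_torsion] at hx
  ext w
  simp [unitLog, hx w]

/-- The logarithmic embedding of the group `E_L` of units modulo torsion. -/
def unitLogModTorsion :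
    Additive ((𝓞 L)ˣ ⧸ torsion L) →+ EuclideanSpace ℝ (InfinitePlace L) :=
  MonoidHom.toAdditiveLeft <|
    QuotientGroup.lift (torsion L) (AddMonoidHom.toMultiplicativeRight (unitLog L))
      fun _ hx => unitLog_eq_zero_of_mem_torsion L hx

theorem unitLogModTorsion_mk (x : (𝓞 L)ˣ) :
    unitLogModTorsion L (Additive.ofMul (QuotientGroup.mk x)) = unitLog L (Additive.ofMul x) :=
  rfl

theorem linearIndependent_unitLogModTorsion {ι : Type*} [Finite ι]
    (b : Module.Basis ι ℤ (Additive ((𝓞 L)ˣ ⧸ torsion L))) :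
    LinearIndependent ℝ fun i => unitLogModTorsion L (b i) := by
  classical
  let π : EuclideanSpace ℝ (InfinitePlace L) →ₗ[ℝ] dirichletUnitTheorem.logSpace L :=
    { toFun := fun x w => x w.1
      map_add' := fun _ _ => rfl
      map_smul' := fun _ _ => rfl }
  have hπ : ∀ x, π (unitLogModTorsion L x) = logEmbeddingEquiv L x := by
    intro x
    obtain ⟨y, hy⟩ := QuotientGroup.mk_surjective x.toMul
    obtain rfl : Additive.ofMul (QuotientGroup.mk y) = x := by rw [hy]; rfl
    rfl
  apply LinearIndependent.of_comp π
  have h := ((b.map (logEmbeddingEquiv L)).ofZLatticeBasis ℝ (unitLattice L)).linearIndependent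
  convert! h using 1
  ext i : 1
  rw [Module.Basis.ofZLatticeBasis_apply, Module.Basis.map_apply]
  exact hπ _

theorem linearIndependent_pair (b : Module.Basis (Fin 2) ℤ (Additive ((𝓞 L)ˣ ⧸ torsion L))) :
    LinearIndependent ℝ ![unitLogModTorsion L (b 0), unitLogModTorsion L (b 1)] := by
  convert linearIndependent_unitLogModTorsion L b using 1
  ext i : 1
  fin_cases i <;> rfl

/-- The shape of the unit lattice computed from a `ℤ`-basis of the units modulo torsion. -/
def shapeOfBasis (b : Module.Basis (Fin 2) ℤ (Additive ((𝓞 L)ˣ ⧸ torsion L))) : ShapeSpace :=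
  toShape (latticePoint (unitLogModTorsion L (b 0)) (unitLogModTorsion L (b 1))
    (linearIndependent_pair L b))

/-- The unit shape `p_L` of a number field with unit group of rank two: the class in
`GL₂(ℤ) \ ℍ` of the unit lattice. It does not depend on the basis; see `unitShape_eq`. -/
def unitShape (h : rank L = 2) : ShapeSpace :=
  shapeOfBasis L ((basisModTorsion L).reindex (finCongr h))

theorem unitShape_eq (h : rank L = 2)
    (b : Module.Basis (Fin 2) ℤ (Additive ((𝓞 L)ˣ ⧸ torsion L))) :
    unitShape L h = shapeOfBasis L b := by
  set b' := (basisModTorsion L).reindex (finCongr h) with hb'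
  have hdet : IsUnit (b.toMatrix b').det := by
    rw [← Module.Basis.det_apply]
    exact b.isUnit_det b'
  rw [Matrix.det_fin_two] at hdet
  have hsum : ∀ j, unitLogModTorsion L (b' j) =
      (b.toMatrix b' 1 j : ℝ) • unitLogModTorsion L (b 1) +
        (b.toMatrix b' 0 j : ℝ) • unitLogModTorsion L (b 0) := by
    intro j
    have h1 := b.sum_toMatrix_smul_self b' j
    rw [Fin.sum_univ_two] at h1
    rw [← h1, map_add, map_zsmul, map_zsmul, add_comm, Int.cast_smul_eq_zsmul,
      Int.cast_smul_eq_zsmul]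
  refine toShape_latticePoint_eq _ _ _ _ _ _ ?_ (hsum 1) (hsum 0)
  rcases Int.isUnit_iff.mp hdet with h2 | h2
  · linear_combination (b.toMatrix b' 0 0 * b.toMatrix b' 1 1
      - b.toMatrix b' 0 1 * b.toMatrix b' 1 0 + 1) * h2
  · linear_combination (b.toMatrix b' 0 0 * b.toMatrix b' 1 1
      - b.toMatrix b' 0 1 * b.toMatrix b' 1 0 - 1) * h2

end Units

/-! ### Quartic fields with group `D₄` and signature `(2, 1)` -/

/-- `L` is a quartic number field with two real places and one complex place whose Galois closure
over `ℚ` has Galois group isomorphic to the dihedral group of order eight. -/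
structure IsD4Quartic (L : Type*) [Field L] [NumberField L] : Prop where
  finrank_eq : Module.finrank ℚ L = 4
  gal : Nonempty
    ((IntermediateField.normalClosure ℚ L (AlgebraicClosure L) ≃ₐ[ℚ]
      IntermediateField.normalClosure ℚ L (AlgebraicClosure L)) ≃* DihedralGroup 4)
  nrRealPlaces_eq : nrRealPlaces L = 2
  nrComplexPlaces_eq : nrComplexPlaces L = 1

theorem IsD4Quartic.rank_eq {L : Type*} [Field L] [NumberField L] (h : IsD4Quartic L) :
    rank L = 2 := by
  have h1 := card_eq_nrRealPlaces_add_nrComplexPlaces L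
  rw [h.nrRealPlaces_eq, h.nrComplexPlaces_eq] at h1
  rw [rank, h1]

/-- The set of unit shapes `p_L` of the `D₄`-quartic fields `L` of signature `(2, 1)` that
contain `K`. -/
def unitShapes (K : Type u) [Field K] : Set ShapeSpace :=
  {p | ∃ (L : Type v) (_ : Field L) (_ : NumberField L) (h : IsD4Quartic L),
    Nonempty (K →+* L) ∧ p = unitShape L h.rank_eq}

/-- The relative discriminant of `L / K`: the relative norm of the different. -/
def relDiscr (K L : Type*) [Field K] [NumberField K] [Field L] [NumberField L] [Algebra K L] :
    Ideal (𝓞 K) :=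
  Ideal.relNorm (𝓞 K) (differentIdeal (𝓞 K) (𝓞 L))

end UnitShape

end

/-!
Let `K` be real quadratic with fundamental unit `ε`, let `L / K` be quadratic with two real places
and one complex place, and let `σ` be the nontrivial automorphism of `L / K`. The unit lattice of
`L` contains the logarithmic vector `u` of `ε`, which is fixed by `σ` and whose length is bounded in
terms of `K` alone. So `Im p_L` can be small only if the whole lattice has small covolume.

If `w` is any nonzero vector of a rank two lattice, the imaginary part of the shape in the
fundamental domain is at least `area (w, x) / ‖w‖²` for some lattice vector `x` independent of `w`
(`exists_sqrt_gram_le`). For `w = u` and `x` the vector of a unit `x`, the automorphism `σ` is an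
isometry fixing `u`, so the distance from `x` to the line through `u` is at least half the length
of the vector of `η = x / σ x` (`norm_mul_norm_sub_le_two_mul_sqrt_gram`). Hence `Im p_L` is at
least a constant times the length of the vector of `η`.

The unit `η` satisfies `σ η = η⁻¹`, and it has infinite order, since otherwise a power of `x` would
lie in `K`, whose units have rank one (`div_conj_notMem_torsion`). So `η` generates `L` over `K`,
and the derivative `η - η⁻¹` of its minimal polynomial at `η` lies in the different. Its norm is at
most exponential in the length of the vector of `η`, which gives
`log N (Disc (L / K)) ≤ 4 log 2 + C · Im p_L` (`exists_log_absNorm_relDiscr_le`). This linear bound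
is stronger than the required one, since `Im p_L` is bounded below on the fundamental domain.

Finiteness of the fields with bounded relative discriminant is Hermite's theorem. It follows that
only finitely many shapes lie below any given height. As the height is locally bounded on the
Hausdorff space `GL₂(ℤ) \ ℍ`, the set of shapes has no limit point
(`derivedSet_eq_empty_of_finite`).
-/

noncomputable section

namespace UnitShape

/-! ### Topology of the moduli space -/

section ModuliSpace

open scoped MatrixGroups Topology
open Filter

/-- `GL₂(ℤ)` contains `SL₂(ℤ)` with finite index. Being arithmetic, it acts properly discontinuously
on `ℍ`, so that the moduli space is Hausdorff. -/
instance isArithmetic_GL2Z : GL2Z.IsArithmetic where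
  is_commensurable := by
    have hle : (𝒮ℒ : Subgroup (GL (Fin 2) ℝ)) ≤ GL2Z := by
      rintro _ ⟨g, rfl⟩
      refine ⟨(g : GL (Fin 2) ℤ), ?_⟩
      ext i j
      rfl
    refine ⟨by rw [Subgroup.relIndex_eq_one.mpr hle]; exact one_ne_zero, ?_⟩
    -- the determinant takes values in the finite group `ℤˣ`
    have hker : (Matrix.GeneralLinearGroup.det (n := Fin 2) (R := ℤ)).ker ≤
        (𝒮ℒ : Subgroup (GL (Fin 2) ℝ)).comap
          (Matrix.GeneralLinearGroup.map (n := Fin 2) (Int.castRingHom ℝ)) := by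
      intro g hg
      have hdet : g.val.det = 1 := by
        rw [MonoidHom.mem_ker] at hg
        rw [← Matrix.GeneralLinearGroup.val_det_apply, hg, Units.val_one]
      refine ⟨⟨g.val, hdet⟩, ?_⟩
      ext i j
      rfl
    have hfin := Subgroup.finiteIndex_of_le hker
    rw [GL2Z, MonoidHom.range_eq_map (Matrix.GeneralLinearGroup.map _), ← Subgroup.relIndex_comap, Subgroup.relIndex_top_right]
    exact hfin.index_ne_zero

theorem representative_im_le (τ : ℍ) : (representative (toShape τ)).im ≤ max τ.im τ.im⁻¹ := by
  obtain ⟨a, b, c, d, hdet, -, him⟩ := toShape_eq_iff_int.mp (toShape_representative (toShape τ))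
  have hτ := τ.im_pos
  have hr := (representative (toShape τ)).im_pos
  set r := (representative (toShape τ)).im
  by_cases hc : c = 0
  · subst hc
    have hd : d ^ 2 = 1 := by
      have : IsUnit (d ^ 2) := by
        apply IsUnit.of_mul_eq_one (a ^ 2)
        linear_combination hdet
      rcases Int.isUnit_iff.mp this with h | h
      · exact h
      · nlinarith
    have hd' : (d : ℝ) ^ 2 = 1 := by exact_mod_cast hd
    refine le_max_of_le_left (le_of_eq ?_)
    simpa [hd'] using him
  · refine le_max_of_le_right ?_
    have hc' : (1 : ℝ) ≤ (c : ℝ) ^ 2 := by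
      have : 0 < c ^ 2 := by positivity
      exact_mod_cast this
    have h1 : r * τ.im ^ 2 ≤ τ.im := by
      rw [← him]
      gcongr
      nlinarith [sq_nonneg (c * τ.re + d : ℝ), sq_nonneg τ.im]
    rw [← one_div, le_div_iff₀ hτ]
    nlinarith

/-- The height `Im` of the representative in the fundamental domain is locally bounded. -/
theorem exists_eventually_representative_im_le (p : ShapeSpace) :
    ∃ M : ℝ, ∀ᶠ q in 𝓝 p, (representative q).im ≤ M := by
  obtain ⟨τ, rfl⟩ := Quotient.exists_rep p
  refine ⟨max τ.im τ.im⁻¹ + 1, ?_⟩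
  have hcont : Continuous fun z : ℍ => max z.im z.im⁻¹ :=
    UpperHalfPlane.continuous_im.max
      (UpperHalfPlane.continuous_im.inv₀ fun z => z.im_ne_zero)
  have hopen : IsOpen {z : ℍ | max z.im z.im⁻¹ < max τ.im τ.im⁻¹ + 1} :=
    isOpen_lt hcont continuous_const
  have hquot : IsOpenMap (toShape : ℍ → ShapeSpace) :=
    (MulAction.isOpenQuotientMap_quotientMk (Γ := GL2Z) (T := ℍ)).isOpenMap
  filter_upwards [(hquot _ hopen).mem_nhds ⟨τ, lt_add_one (max τ.im τ.im⁻¹), rfl⟩]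
  rintro _ ⟨z, hz, rfl⟩
  exact (representative_im_le z).trans hz.le

/-- A set of shapes with only finitely many members below each height has no limit point, because
the moduli space is Hausdorff and the height is locally bounded. -/
theorem derivedSet_eq_empty_of_finite {S : Set ShapeSpace}
    (hS : ∀ M : ℝ, {p ∈ S | (representative p).im ≤ M}.Finite) : derivedSet S = ∅ := by
  refine Set.eq_empty_of_forall_notMem fun p hp => ?_
  rw [mem_derivedSet, accPt_iff_frequently] at hp
  obtain ⟨M, hM⟩ := exists_eventually_representative_im_le p
  have hfin : ({p ∈ S | (representative p).im ≤ M} \ {p}).Finite := (hS M).subset Set.sdiff_subset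
  have hev : ∀ᶠ q in 𝓝 p, q ∉ {p ∈ S | (representative p).im ≤ M} \ {p} :=
    hfin.isClosed.isOpen_compl.mem_nhds fun h => h.2 rfl
  apply hp
  filter_upwards [hM, hev] with q hq1 hq2 hq3
  exact hq2 ⟨⟨hq3.2, hq1⟩, hq3.1⟩

theorem half_le_im_of_mem_fundamentalDomain {τ : ℍ} (hτ : τ ∈ fundamentalDomain) :
    1 / 2 ≤ τ.im := by
  obtain ⟨h0, h1, h2⟩ := hτ
  nlinarith [τ.im_pos]

/-- The height of the class of `τ` is at least `Im τ / |m + nτ|²`, the value attached to the lattice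
vector `m + nτ`: a shortest vector gives the height itself. -/
theorem im_le_representative_im_mul (τ : ℍ) {m n : ℤ} (h : m ≠ 0 ∨ n ≠ 0) :
    τ.im ≤ (representative (toShape τ)).im * ((m + n * τ.re) ^ 2 + (n * τ.im) ^ 2) := by
  obtain ⟨a, b, c, d, hdet, hre, him⟩ :=
    toShape_eq_iff_int.mp (toShape_representative (toShape τ)).symm
  have hfd := representative_mem (toShape τ)
  set z := representative (toShape τ)
  have hdet' : ((a : ℝ) * d - b * c) ^ 2 = 1 := by exact_mod_cast hdet
  have hne : (m * c + n * a) ≠ 0 ∨ (m * d + n * b) ≠ 0 := by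
    by_contra! hcon
    have hd0 : a * d - b * c ≠ 0 := fun h0 => by simp [h0] at hdet
    have hn : n * (a * d - b * c) = 0 := by linear_combination d * hcon.1 - c * hcon.2
    have hm : m * (a * d - b * c) = 0 := by linear_combination a * hcon.2 - b * hcon.1
    rcases h with h | h
    · exact h ((mul_eq_zero.mp hm).resolve_right hd0)
    · exact h ((mul_eq_zero.mp hn).resolve_right hd0)
  have hD := (one_le_denom hfd hne).1
  push_cast at hD
  set D := (c * z.re + d) ^ 2 + (c * z.im) ^ 2
  have hDpos : 0 < D := by
    have := z.im_pos
    have h1 := τ.im_pos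
    by_contra! hcon
    nlinarith
  -- `m + nτ = (m (cz + d) + n (az + b)) / (cz + d)` for `τ = (az + b) / (cz + d)`
  have hkey : ((m + n * τ.re) ^ 2 + (n * τ.im) ^ 2) * D =
      ((m * c + n * a) * z.re + (m * d + n * b)) ^ 2 + ((m * c + n * a) * z.im) ^ 2 := by
    have hsq : (τ.re ^ 2 + τ.im ^ 2) * D = (a * z.re + b) ^ 2 + (a * z.im) ^ 2 := by
      have h1 : (τ.re * D) ^ 2 + (τ.im * D) ^ 2 =
          ((a * z.re + b) ^ 2 + (a * z.im) ^ 2) * D := by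
        rw [hre, him]
        linear_combination (-z.im ^ 2) * hdet'
      have h2 : ((τ.re ^ 2 + τ.im ^ 2) * D) * D =
          ((a * z.re + b) ^ 2 + (a * z.im) ^ 2) * D := by rw [← h1]; ring
      exact mul_right_cancel₀ hDpos.ne' h2
    linear_combination (2 * m * n : ℝ) * hre + (n : ℝ) ^ 2 * hsq
  have hz := z.im_pos
  refine le_of_mul_le_mul_right ?_ hDpos
  rw [him, mul_assoc, hkey]
  exact le_mul_of_one_le_right hz.le hD

end ModuliSpace

/-! ### Lattices with a short vector -/

section Lattice

variable {E : Type*} [NormedAddCommGroup E] [InnerProductSpace ℝ E]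

/-- The Gram determinant of two vectors, the square of the area they span. -/
def gram (u v : E) : ℝ := ‖u‖ ^ 2 * ‖v‖ ^ 2 - inner ℝ u v ^ 2

theorem gram_smul_add_smul (u v : E) (a b c d : ℝ) :
    gram (a • u + b • v) (c • u + d • v) = (a * d - b * c) ^ 2 * gram u v := by
  simp only [gram, ← real_inner_self_eq_norm_sq, inner_add_left, inner_add_right,
    real_inner_smul_left, real_inner_smul_right, real_inner_comm u v]
  ring

/-- Every nonzero vector `w` of a rank two lattice, which may be a multiple of another lattice
vector, bounds the height of the shape from below by `area (w, x) / ‖w‖²` for some lattice vector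
`x` independent of `w`. -/
theorem exists_sqrt_gram_le (u v : E) (h : LinearIndependent ℝ ![u, v]) {m n : ℤ}
    (hmn : m ≠ 0 ∨ n ≠ 0) :
    ∃ k l : ℤ, 0 < gram ((m : ℝ) • u + (n : ℝ) • v) ((k : ℝ) • u + (l : ℝ) • v) ∧
      √(gram ((m : ℝ) • u + (n : ℝ) • v) ((k : ℝ) • u + (l : ℝ) • v)) ≤
        (representative (toShape (latticePoint u v h))).im *
          ‖(m : ℝ) • u + (n : ℝ) • v‖ ^ 2 := by
  -- `w = g w₀` with `w₀` primitive, and `w₀, x` is a basis of the lattice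
  obtain ⟨g, m₀, n₀, hg, hcop, rfl, rfl⟩ : ∃ g m₀ n₀ : ℤ, 1 ≤ g ∧ IsCoprime m₀ n₀ ∧
      m = g * m₀ ∧ n = g * n₀ := by
    have hpos : 0 < Int.gcd m n := Int.gcd_pos_iff.mpr hmn
    obtain ⟨m₀, n₀, hcop, hm, hn⟩ := Int.exists_gcd_one hpos
    exact ⟨Int.gcd m n, m₀, n₀, by exact_mod_cast hpos, Int.isCoprime_iff_gcd_eq_one.mpr hcop,
      by rw [mul_comm]; exact hm, by rw [mul_comm]; exact hn⟩
  obtain ⟨r, s, hrs⟩ := hcop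
  have hrs' : (r : ℝ) * m₀ + s * n₀ = 1 := by exact_mod_cast hrs
  have hg' : (1 : ℝ) ≤ g := by exact_mod_cast hg
  have hgram : 0 < gram u v := gram_pos h
  have hG : gram (((g * m₀ : ℤ) : ℝ) • u + ((g * n₀ : ℤ) : ℝ) • v)
      (((-s : ℤ) : ℝ) • u + (r : ℝ) • v) = (g : ℝ) ^ 2 * gram u v := by
    rw [gram_smul_add_smul]
    push_cast
    linear_combination (g : ℝ) ^ 2 * gram u v * (r * m₀ + s * n₀ + 1) * hrs'
  have hne : m₀ ≠ 0 ∨ n₀ ≠ 0 := by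
    by_contra! hcon
    simp [hcon.1, hcon.2] at hrs
  refine ⟨-s, r, by rw [hG]; positivity, ?_⟩
  have hu : 0 < ‖u‖ := norm_pos_iff.mpr (h.ne_zero 0)
  have him : √(gram u v) = ‖u‖ ^ 2 * (latticePoint u v h).im := by
    rw [latticePoint_im, gram]
    field_simp
  have hle := im_le_representative_im_mul (latticePoint u v h) hne
  have hy := (representative (toShape (latticePoint u v h))).im_pos
  rw [hG, Real.sqrt_mul (sq_nonneg _), Real.sqrt_sq (by linarith), him, norm_sq_smul_add_smul u v h]
  set y := (representative (toShape (latticePoint u v h))).im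
  set τ := latticePoint u v h
  calc (g : ℝ) * (‖u‖ ^ 2 * τ.im)
      ≤ (g : ℝ) ^ 2 * (‖u‖ ^ 2 * (y * ((m₀ + n₀ * τ.re) ^ 2 + (n₀ * τ.im) ^ 2))) := by
        gcongr
        nlinarith
    _ = _ := by push_cast; ring

/-- If `x'` has the same norm as `x` and the same inner product with `w`, as happens for the image
of `x` under an isometry that fixes `w`, then `x` lies at a distance of at least `‖x - x'‖ / 2` from
the line through `w`. -/
theorem norm_mul_norm_sub_le_two_mul_sqrt_gram {w x x' : E} (hnorm : ‖x'‖ = ‖x‖)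
    (hinner : inner ℝ w x' = inner ℝ w x) : ‖w‖ * ‖x - x'‖ ≤ 2 * √(gram w x) := by
  have h1 : inner ℝ w (x - x') = 0 := by rw [inner_sub_right, hinner, sub_self]
  have h2 : inner ℝ x (x - x') = ‖x - x'‖ ^ 2 / 2 := by
    rw [norm_sub_sq_real, inner_sub_right, real_inner_self_eq_norm_sq, hnorm]
    ring
  rcases (norm_nonneg w).eq_or_lt' with hw | hw
  · rw [hw, zero_mul]
    positivity
  rcases (norm_nonneg (x - x')).eq_or_lt' with hz | hz
  · rw [hz, mul_zero]
    positivity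
  -- `‖w‖² x - ⟨w, x⟩ w` is `‖w‖²` times the component of `x` orthogonal to `w`
  have hcs := abs_real_inner_le_norm (‖w‖ ^ 2 • x - inner ℝ w x • w) (x - x')
  rw [inner_sub_left, real_inner_smul_left, real_inner_smul_left, h1, h2, mul_zero, sub_zero,
    abs_of_nonneg (by positivity)] at hcs
  have hy : ‖‖w‖ ^ 2 • x - inner ℝ w x • w‖ ^ 2 = ‖w‖ ^ 2 * gram w x := by
    rw [norm_sub_sq_real, norm_smul, norm_smul, real_inner_smul_left, real_inner_smul_right,
      real_inner_comm w x, mul_pow, mul_pow, Real.norm_eq_abs, Real.norm_eq_abs, sq_abs, sq_abs,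
      gram]
    ring
  have hgram : 0 ≤ gram w x := by
    have : 0 ≤ ‖w‖ ^ 2 * gram w x := hy ▸ sq_nonneg _
    exact nonneg_of_mul_nonneg_right this (by positivity)
  have hy' : ‖‖w‖ ^ 2 • x - inner ℝ w x • w‖ = ‖w‖ * √(gram w x) := by
    rw [← Real.sqrt_sq (norm_nonneg (‖w‖ ^ 2 • x - inner ℝ w x • w)), hy,
      Real.sqrt_mul (sq_nonneg _), Real.sqrt_sq hw.le]
  rw [hy'] at hcs
  have hpos : 0 < ‖w‖ * ‖x - x'‖ := by positivity
  refine le_of_mul_le_mul_left ?_ hpos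
  linarith

end Lattice

/-! ### Isomorphisms and the unit lattice -/

section Isomorphism

variable {L : Type u} {L' : Type v} [Field L] [Field L']

/-- The bijection of infinite places induced by an isomorphism of fields. -/
def placeEquiv (e : L ≃+* L') : InfinitePlace L' ≃ InfinitePlace L where
  toFun w := w.comap e
  invFun w := w.comap e.symm
  left_inv w := by ext x; simp
  right_inv w := by ext x; simp

theorem mult_placeEquiv (e : L ≃+* L') (w : InfinitePlace L') :
    mult (placeEquiv e w) = mult w := by
  refine le_antisymm (mult_comap_le _ _) ?_
  conv_lhs => rw [← (placeEquiv e).left_inv w]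
  exact mult_comap_le _ _

/-- The isomorphism of unit groups induced by an isomorphism of fields. -/
def unitsEquiv (e : L ≃+* L') : (𝓞 L)ˣ ≃* (𝓞 L')ˣ :=
  Units.mapEquiv (RingOfIntegers.mapRingEquiv e).toMulEquiv

theorem coe_unitsEquiv (e : L ≃+* L') (x : (𝓞 L)ˣ) : (unitsEquiv e x : L') = e (x : L) := rfl

theorem map_torsion_unitsEquiv (e : L ≃+* L') :
    (torsion L).map (unitsEquiv e : (𝓞 L)ˣ →* (𝓞 L')ˣ) = torsion L' := by
  ext y
  refine Subgroup.mem_map_equiv.trans ?_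
  exact Function.Injective.isOfFinOrder_iff (f := (unitsEquiv e).symm.toMonoidHom)
    (unitsEquiv e).symm.injective

/-- The isomorphism of units modulo torsion induced by an isomorphism of fields. -/
def modTorsionEquiv (e : L ≃+* L') :
    Additive ((𝓞 L)ˣ ⧸ torsion L) ≃+ Additive ((𝓞 L')ˣ ⧸ torsion L') :=
  MulEquiv.toAdditive
    (QuotientGroup.congr (torsion L) (torsion L') (unitsEquiv e) (map_torsion_unitsEquiv e))

variable [NumberField L] [NumberField L']

theorem inner_unitLog (x y : (𝓞 L)ˣ) :
    inner ℝ (unitLog L (Additive.ofMul x)) (unitLog L (Additive.ofMul y)) =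
      ∑ w : InfinitePlace L, ((mult w : ℝ) * Real.log (w (x : L))) *
        ((mult w : ℝ) * Real.log (w (y : L))) := by
  rw [PiLp.inner_apply]
  refine Finset.sum_congr rfl fun w _ => ?_
  rw [real_inner_eq_re_inner, RCLike.inner_apply, mul_comm]
  rfl

theorem inner_unitLog_unitsEquiv (e : L ≃+* L') (x y : (𝓞 L)ˣ) :
    inner ℝ (unitLog L' (Additive.ofMul (unitsEquiv e x)))
        (unitLog L' (Additive.ofMul (unitsEquiv e y))) =
      inner ℝ (unitLog L (Additive.ofMul x)) (unitLog L (Additive.ofMul y)) := by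
  rw [inner_unitLog, inner_unitLog, ← (placeEquiv e).sum_comp]
  refine Finset.sum_congr rfl fun w _ => ?_
  rw [mult_placeEquiv, coe_unitsEquiv, coe_unitsEquiv]
  rfl

theorem norm_unitLog_unitsEquiv (e : L ≃+* L') (x : (𝓞 L)ˣ) :
    ‖unitLog L' (Additive.ofMul (unitsEquiv e x))‖ = ‖unitLog L (Additive.ofMul x)‖ := by
  rw [norm_eq_sqrt_real_inner, inner_unitLog_unitsEquiv, ← norm_eq_sqrt_real_inner]

theorem inner_modTorsionEquiv (e : L ≃+* L') (x y : Additive ((𝓞 L)ˣ ⧸ torsion L)) :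
    inner ℝ (unitLogModTorsion L' (modTorsionEquiv e x))
        (unitLogModTorsion L' (modTorsionEquiv e y)) =
      inner ℝ (unitLogModTorsion L x) (unitLogModTorsion L y) := by
  obtain ⟨x, rfl⟩ := Additive.ofMul.surjective x
  obtain ⟨y, rfl⟩ := Additive.ofMul.surjective y
  obtain ⟨x, rfl⟩ := QuotientGroup.mk_surjective x
  obtain ⟨y, rfl⟩ := QuotientGroup.mk_surjective y
  exact inner_unitLog_unitsEquiv e x y

/-- Isomorphic fields have the same unit shape. -/
theorem unitShape_congr (e : L ≃+* L') (h : rank L = 2) (h' : rank L' = 2) :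
    unitShape L' h' = unitShape L h := by
  set b := (basisModTorsion L).reindex (finCongr h)
  rw [unitShape_eq L h b, unitShape_eq L' h' (b.map (modTorsionEquiv e).toIntLinearEquiv)]
  have hin : ∀ i j, inner ℝ (unitLogModTorsion L' ((b.map (modTorsionEquiv e).toIntLinearEquiv) i))
      (unitLogModTorsion L' ((b.map (modTorsionEquiv e).toIntLinearEquiv) j)) =
      inner ℝ (unitLogModTorsion L (b i)) (unitLogModTorsion L (b j)) := fun i j =>
    inner_modTorsionEquiv e (b i) (b j)
  unfold shapeOfBasis
  congr 1
  apply UpperHalfPlane.ext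
  apply Complex.ext
  · rw [UpperHalfPlane.coe_re, UpperHalfPlane.coe_re, latticePoint_re, latticePoint_re]
    simp only [← real_inner_self_eq_norm_sq, hin]
  · rw [UpperHalfPlane.coe_im, UpperHalfPlane.coe_im, latticePoint_im, latticePoint_im]
    simp only [← real_inner_self_eq_norm_sq, hin]

end Isomorphism

/-! ### Fields of bounded relative discriminant -/

section Finiteness

variable (K : Type u) [Field K] [NumberField K]

theorem absNorm_relDiscr (L : Type v) [Field L] [NumberField L] [Algebra K L] :
    Ideal.absNorm (relDiscr K L) = Ideal.absNorm (differentIdeal (𝓞 K) (𝓞 L)) := by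
  rw [relDiscr, Ideal.absNorm_relNorm]

theorem natAbs_discr_eq (L : Type v) [Field L] [NumberField L] [Algebra K L] :
    (discr L).natAbs =
      Ideal.absNorm (relDiscr K L) * (discr K).natAbs ^ Module.finrank K L := by
  rw [absNorm_relDiscr]
  exact natAbs_discr_eq_absNorm_differentIdeal_mul_natAbs_discr_pow K (𝓞 K) L (𝓞 L)

/-- By Hermite's theorem, there are finitely many extensions of a number field with bounded degree
and bounded relative discriminant. -/
theorem exists_finite_of_absNorm_relDiscr_le (n N : ℕ) :
    ∃ S : Set (IntermediateField ℚ (AlgebraicClosure ℚ)), S.Finite ∧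
      ∀ (L : Type v) [Field L] [NumberField L] [Algebra K L], Module.finrank K L ≤ n →
        Ideal.absNorm (relDiscr K L) ≤ N → ∃ F ∈ S, Nonempty (L ≃+* F) := by
  refine ⟨_, (NumberField.finite_of_discr_bdd (AlgebraicClosure ℚ)
    (N * (discr K).natAbs ^ n)).image Subtype.val, ?_⟩
  intro L _ _ _ hn hN
  let f : L →ₐ[ℚ] AlgebraicClosure ℚ := IsAlgClosed.lift
  let e : L ≃ₐ[ℚ] f.fieldRange := AlgEquiv.ofInjectiveField f
  have hfin : FiniteDimensional ℚ f.fieldRange := e.toLinearEquiv.finiteDimensional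
  refine ⟨f.fieldRange, ⟨⟨f.fieldRange, hfin⟩, ?_, rfl⟩, ⟨e.toRingEquiv⟩⟩
  have : NumberField f.fieldRange := @NumberField.mk _ _ inferInstance hfin
  change |discr f.fieldRange| ≤ _
  rw [← NumberField.discr_eq_discr_of_algEquiv L e, Int.abs_eq_natAbs, natAbs_discr_eq K L]
  have hK : 1 ≤ (discr K).natAbs := Int.natAbs_pos.mpr (discr_ne_zero K)
  exact_mod_cast Nat.mul_le_mul hN (Nat.pow_le_pow_right hK hn)

end Finiteness

/-! ### Lower bounds for the height of the unit shape -/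

section UnitLattice

variable (L : Type v) [Field L]

theorem mem_torsion_of_inv_eq_self {x : (𝓞 L)ˣ} (hx : x⁻¹ = x) : x ∈ torsion L :=
  isOfFinOrder_iff_pow_eq_one.mpr ⟨2, two_pos, by rw [sq, mul_eq_one_iff_inv_eq, hx]⟩

theorem unitLog_pow (x : (𝓞 L)ˣ) (n : ℕ) :
    unitLog L (Additive.ofMul (x ^ n)) = (n : ℝ) • unitLog L (Additive.ofMul x) := by
  rw [ofMul_pow, map_nsmul, Nat.cast_smul_eq_nsmul]

theorem unitLog_zpow (x : (𝓞 L)ˣ) (n : ℤ) :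
    unitLog L (Additive.ofMul (x ^ n)) = (n : ℝ) • unitLog L (Additive.ofMul x) := by
  rw [ofMul_zpow, map_zsmul, Int.cast_smul_eq_zsmul]

variable [NumberField L]

/-- The lattice bound for the unit shape: a unit `u` of infinite order bounds its height from below
by `area (u, x) / ‖u‖²` for some unit `x` independent of `u`. -/
theorem exists_unit_sqrt_gram_le (h : rank L = 2) {u : (𝓞 L)ˣ} (hu : u ∉ torsion L) :
    ∃ x : (𝓞 L)ˣ,
      0 < gram (unitLog L (Additive.ofMul u)) (unitLog L (Additive.ofMul x)) ∧
      √(gram (unitLog L (Additive.ofMul u)) (unitLog L (Additive.ofMul x))) ≤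
        (representative (unitShape L h)).im * ‖unitLog L (Additive.ofMul u)‖ ^ 2 := by
  set b := (basisModTorsion L).reindex (finCongr h)
  have hcomb : ∀ m n : ℤ, unitLogModTorsion L (m • b 0 + n • b 1) =
      (m : ℝ) • unitLogModTorsion L (b 0) + (n : ℝ) • unitLogModTorsion L (b 1) := by
    intro m n
    rw [map_add, map_zsmul, map_zsmul, Int.cast_smul_eq_zsmul, Int.cast_smul_eq_zsmul]
  set U : Additive ((𝓞 L)ˣ ⧸ torsion L) := Additive.ofMul (QuotientGroup.mk u) with hU
  have hsum : b.repr U 0 • b 0 + b.repr U 1 • b 1 = U := by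
    rw [← Fin.sum_univ_two (fun i => b.repr U i • b i), b.sum_repr]
  have hne : b.repr U 0 ≠ 0 ∨ b.repr U 1 ≠ 0 := by
    by_contra! hcon
    rw [hcon.1, hcon.2, zero_smul, zero_smul, add_zero] at hsum
    exact hu ((QuotientGroup.eq_one_iff u).mp hsum.symm)
  obtain ⟨k, l, hpos, hle⟩ := exists_sqrt_gram_le _ _ (linearIndependent_pair L b) hne
  rw [← hcomb, ← hcomb, hsum, hU, unitLogModTorsion_mk] at hpos hle
  obtain ⟨x, hx⟩ := QuotientGroup.mk_surjective (k • b 0 + l • b 1).toMul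
  have hx' : unitLogModTorsion L (k • b 0 + l • b 1) = unitLog L (Additive.ofMul x) := by
    rw [← unitLogModTorsion_mk, hx]
    rfl
  rw [hx'] at hpos hle
  exact ⟨x, hpos, hle⟩

end UnitLattice

/-! ### Units in quadratic extensions -/

section Quadratic

variable {K : Type u} {L : Type v} [Field K] [Field L] [Algebra K L]

theorem exists_conj_of_finrank_eq_two [CharZero K] (h2 : Module.finrank K L = 2) :
    ∃ σ : L ≃ₐ[K] L, (∀ x, σ (σ x) = x) ∧ ∀ x, σ x = x → ∃ y, algebraMap K L y = x := by
  have hfin : FiniteDimensional K L := Module.finite_of_finrank_eq_succ h2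
  have hquad : Algebra.IsQuadraticExtension K L := { finrank_eq_two' := h2 }
  have hgal : IsGalois K L := ⟨⟩
  have hcard : Nat.card (L ≃ₐ[K] L) = 2 := by rw [IsGalois.card_aut_eq_finrank, h2]
  obtain ⟨σ, hσ, huniv⟩ := (Nat.card_eq_two_iff' (1 : L ≃ₐ[K] L)).mp hcard
  refine ⟨σ, fun x => ?_, fun x hx => ?_⟩
  · have hsq : σ * σ = 1 := by
      by_contra hne
      exact hσ (mul_left_cancel ((huniv _ hne).trans (mul_one σ).symm))
    exact DFunLike.congr_fun hsq x
  · refine Algebra.mem_bot.mp ((IsGalois.mem_bot_iff_fixed (F := K) x).mpr fun τ => ?_)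
    by_cases hτ : τ = 1
    · rw [hτ]; rfl
    · rw [huniv τ hτ, hx]

open Polynomial in
theorem aeval_derivative_minpoly_of_conj (h2 : Module.finrank K L = 2) (σ : L ≃ₐ[K] L) {x : L}
    (hx : σ x ≠ x) : aeval x (derivative (minpoly K x)) = x - σ x := by
  have hfin : FiniteDimensional K L := Module.finite_of_finrank_eq_succ h2
  have hint : IsIntegral K x := Algebra.IsIntegral.isIntegral x
  have hroot : ∀ y, aeval y (minpoly K x) = 0 →
      X - C y ∣ (minpoly K x).map (algebraMap K L) := by
    intro y hy
    rw [dvd_iff_isRoot, IsRoot.def, eval_map_algebraMap, hy]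
  have hdvd : (X - C x) * (X - C (σ x)) ∣ (minpoly K x).map (algebraMap K L) := by
    refine IsCoprime.mul_dvd ?_ (hroot _ (minpoly.aeval K x)) (hroot _ ?_)
    · exact isCoprime_X_sub_C_of_isUnit_sub (sub_ne_zero.mpr hx.symm).isUnit
    · rw [aeval_algHom_apply, minpoly.aeval, map_zero]
  have heq := eq_of_monic_of_dvd_of_natDegree_le ((monic_X_sub_C x).mul (monic_X_sub_C (σ x)))
    ((minpoly.monic hint).map _) hdvd (by
      rw [(monic_X_sub_C x).natDegree_mul (monic_X_sub_C _), natDegree_X_sub_C, natDegree_X_sub_C,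
        (minpoly.monic hint).natDegree_map]
      exact (minpoly.natDegree_le x).trans h2.le)
  rw [← eval_map_algebraMap, ← derivative_map, heq]
  simp

theorem log_place_sub_inv_le (w : InfinitePlace L) (η : (𝓞 L)ˣ)
    (hne : (η : L) - ((η⁻¹ : (𝓞 L)ˣ) : L) ≠ 0) :
    Real.log (w ((η : L) - ((η⁻¹ : (𝓞 L)ˣ) : L))) ≤ Real.log 2 + |Real.log (w (η : L))| := by
  have hη : 0 < w (η : L) := pos_iff.mpr (Units.coe_ne_zero η)
  have hinv : w ((η⁻¹ : (𝓞 L)ˣ) : L) = (w (η : L))⁻¹ := by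
    rw [map_units_inv, map_inv₀]
  have h1 : w (η : L) ≤ Real.exp |Real.log (w (η : L))| := by
    conv_lhs => rw [← Real.exp_log hη]
    exact Real.exp_le_exp.mpr (le_abs_self _)
  have h2 : (w (η : L))⁻¹ ≤ Real.exp |Real.log (w (η : L))| := by
    conv_lhs => rw [← Real.exp_log hη, ← Real.exp_neg]
    exact Real.exp_le_exp.mpr (neg_le_abs _)
  have h3 : w ((η : L) - ((η⁻¹ : (𝓞 L)ˣ) : L)) ≤ 2 * Real.exp |Real.log (w (η : L))| := by
    have := w.1.sub_le_add (η : L) ((η⁻¹ : (𝓞 L)ˣ) : L)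
    change w ((η : L) - ((η⁻¹ : (𝓞 L)ˣ) : L)) ≤ w (η : L) + w ((η⁻¹ : (𝓞 L)ˣ) : L) at this
    linarith
  calc Real.log (w ((η : L) - ((η⁻¹ : (𝓞 L)ˣ) : L)))
      ≤ Real.log (2 * Real.exp |Real.log (w (η : L))|) :=
        Real.log_le_log (pos_iff.mpr hne) h3
    _ = _ := by rw [Real.log_mul two_ne_zero (Real.exp_ne_zero _), Real.log_exp]

/-- The map on units induced by the inclusion of a subfield. -/
def unitsInclusion (K : Type u) (L : Type v) [Field K] [Field L] [Algebra K L] :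
    (𝓞 K)ˣ →* (𝓞 L)ˣ :=
  Units.map (algebraMap (𝓞 K) (𝓞 L) : 𝓞 K →* 𝓞 L)

theorem coe_unitsInclusion (y : (𝓞 K)ˣ) :
    (unitsInclusion K L y : L) = algebraMap K L (y : K) := rfl

theorem unitsInclusion_mem_torsion_iff {y : (𝓞 K)ˣ} :
    unitsInclusion K L y ∈ torsion L ↔ y ∈ torsion K :=
  Function.Injective.isOfFinOrder_iff (f := unitsInclusion K L)
    (Units.map_injective (FaithfulSMul.algebraMap_injective (𝓞 K) (𝓞 L)))

variable [NumberField K] [NumberField L]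

open Polynomial in
theorem sub_conj_mem_differentIdeal (h2 : Module.finrank K L = 2) (σ : L ≃ₐ[K] L) {x y : 𝓞 L}
    (hy : σ x = y) (hx : y ≠ x) : x - y ∈ differentIdeal (𝓞 K) (𝓞 L) := by
  have hne : σ (x : L) ≠ x := by
    rw [hy]
    exact fun h => hx (RingOfIntegers.ext h)
  have hadj : Algebra.adjoin K {algebraMap (𝓞 L) L x} = ⊤ := by
    have := Subalgebra.isSimpleOrder_of_finrank h2
    refine (eq_bot_or_eq_top _).resolve_left fun hbot => hne ?_
    have hmem : (x : L) ∈ (⊥ : Subalgebra K L) := by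
      rw [← hbot]
      exact Algebra.self_mem_adjoin_singleton K _
    obtain ⟨k, hk⟩ := Algebra.mem_bot.mp hmem
    rw [← hk, AlgEquiv.commutes]
  have hmem := aeval_derivative_mem_differentIdeal (𝓞 K) K L x hadj
  convert hmem
  apply RingOfIntegers.ext
  have hint : IsIntegral (𝓞 K) x := Algebra.IsIntegral.isIntegral x
  have h := aeval_derivative_minpoly_of_conj h2 σ hne
  rw [minpoly.isIntegrallyClosed_eq_field_fractions K L hint, derivative_map,
    aeval_map_algebraMap, aeval_algebraMap_apply, hy] at h
  exact (map_sub (algebraMap (𝓞 L) L) x y).trans h.symm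

/-- A relative unit `η` of infinite order generates `L` over `K`, and `η - η⁻¹` lies in the
different. Its norm is bounded in terms of the length of the logarithmic vector of `η`. -/
theorem log_absNorm_relDiscr_le (h2 : Module.finrank K L = 2) (σ : L ≃ₐ[K] L) {η : (𝓞 L)ˣ}
    (hση : σ (η : L) = ((η⁻¹ : (𝓞 L)ˣ) : L)) (hη : η ∉ torsion L) :
    Real.log (Ideal.absNorm (relDiscr K L)) ≤ Module.finrank ℚ L * Real.log 2 +
      Fintype.card (InfinitePlace L) * ‖unitLog L (Additive.ofMul η)‖ := by
  have hne : ((η⁻¹ : (𝓞 L)ˣ) : 𝓞 L) ≠ (η : 𝓞 L) :=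
    fun h => hη (mem_torsion_of_inv_eq_self L (Units.ext h))
  set δ : 𝓞 L := (η : 𝓞 L) - ((η⁻¹ : (𝓞 L)ˣ) : 𝓞 L) with hδ
  have hδ0 : δ ≠ 0 := sub_ne_zero.mpr hne.symm
  have hδL : (δ : L) = (η : L) - ((η⁻¹ : (𝓞 L)ˣ) : L) := map_sub _ _ _
  have hδL0 : (δ : L) ≠ 0 := RingOfIntegers.coe_ne_zero_iff.mpr hδ0
  have hmem : δ ∈ differentIdeal (𝓞 K) (𝓞 L) := sub_conj_mem_differentIdeal h2 σ hση hne
  have hnorm : Algebra.norm ℤ δ ≠ 0 := Algebra.norm_ne_zero_iff.mpr hδ0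
  have hle : (Ideal.absNorm (relDiscr K L) : ℝ) ≤ |(Algebra.norm ℚ (δ : L) : ℝ)| := by
    rw [absNorm_relDiscr, ← Algebra.coe_norm_int]
    exact_mod_cast Int.le_of_dvd (abs_pos.mpr hnorm)
      ((dvd_abs _ _).mpr (Ideal.absNorm_dvd_norm_of_mem hmem))
  have hprod := prod_eq_abs_norm (δ : L)
  rw [Rat.cast_abs] at hprod
  have hposN : 0 < (Ideal.absNorm (relDiscr K L) : ℝ) := by
    rw [absNorm_relDiscr]
    have : Ideal.absNorm (differentIdeal (𝓞 K) (𝓞 L)) ≠ 0 := by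
      rw [Ne, Ideal.absNorm_eq_zero_iff]
      exact differentIdeal_ne_bot
    positivity
  calc Real.log (Ideal.absNorm (relDiscr K L))
      ≤ Real.log (∏ w : InfinitePlace L, w (δ : L) ^ mult w) := by
        rw [hprod]
        exact Real.log_le_log hposN hle
    _ = ∑ w : InfinitePlace L, (mult w : ℝ) * Real.log (w (δ : L)) := by
        rw [Real.log_prod fun w _ => pow_ne_zero _ ((map_ne_zero w).mpr hδL0)]
        simp only [Real.log_pow]
    _ ≤ ∑ w : InfinitePlace L, ((mult w : ℝ) * Real.log 2 +
          ‖unitLog L (Additive.ofMul η)‖) := by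
        refine Finset.sum_le_sum fun w _ => ?_
        have h1 := log_place_sub_inv_le w η (hδL ▸ hδL0)
        rw [← hδL] at h1
        have h2 : (mult w : ℝ) * |Real.log (w (η : L))| ≤ ‖unitLog L (Additive.ofMul η)‖ := by
          have := PiLp.norm_apply_le (unitLog L (Additive.ofMul η)) w
          rwa [show (unitLog L (Additive.ofMul η)) w = (mult w : ℝ) * Real.log (w (η : L)) from rfl,
            Real.norm_eq_abs, abs_mul, Nat.abs_cast] at this
        calc (mult w : ℝ) * Real.log (w (δ : L))
            ≤ (mult w : ℝ) * (Real.log 2 + |Real.log (w (η : L))|) := by gcongr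
          _ ≤ _ := by rw [mul_add]; gcongr
    _ = _ := by
        rw [Finset.sum_add_distrib, ← Finset.sum_mul, ← Nat.cast_sum, sum_mult_eq,
          Finset.sum_const, nsmul_eq_mul, Finset.card_univ]

/-- If `K` has unit rank one, all units of `K` have proportional logarithmic vectors. -/
theorem exists_unitLog_unitsInclusion_eq (i : Fin (rank K)) (h1 : rank K = 1) (y : (𝓞 K)ˣ) :
    ∃ n : ℤ, unitLog L (Additive.ofMul (unitsInclusion K L y)) =
      (n : ℝ) • unitLog L (Additive.ofMul (unitsInclusion K L (fundSystem K i))) := by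
  obtain ⟨⟨ζ, e⟩, hy, -⟩ := exist_unique_eq_mul_prod K y
  have hsub : Subsingleton (Fin (rank K)) := by rw [h1]; infer_instance
  refine ⟨e i, ?_⟩
  have hζ := unitLog_eq_zero_of_mem_torsion L
    (unitsInclusion_mem_torsion_iff (L := L).mpr ζ.2)
  rw [hy, Fintype.prod_subsingleton _ i, map_mul, map_zpow, ofMul_mul, map_add, hζ, zero_add,
    unitLog_zpow]

/-- If `x / σ x` were a root of unity, a power of `x` would lie in `K`, so the logarithmic vector of
`x` would be proportional to that of the fundamental unit of `K`. -/
theorem div_conj_notMem_torsion (h2 : Module.finrank K L = 2) (h1 : rank K = 1)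
    (i : Fin (rank K)) {σ : L ≃ₐ[K] L} (hσ : ∀ x, σ x = x → ∃ y, algebraMap K L y = x)
    {x : (𝓞 L)ˣ} (hx : 0 < gram (unitLog L (Additive.ofMul (unitsInclusion K L (fundSystem K i))))
      (unitLog L (Additive.ofMul x))) :
    x / unitsEquiv σ.toRingEquiv x ∉ torsion L := by
  intro htor
  obtain ⟨n, hn, hpow⟩ := isOfFinOrder_iff_pow_eq_one.mp htor
  rw [div_pow, div_eq_one, ← map_pow] at hpow
  obtain ⟨k, hk⟩ := hσ ((x ^ n : (𝓞 L)ˣ) : L) (congrArg (fun z : (𝓞 L)ˣ => (z : L)) hpow).symm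
  -- the relative norm of the unit `x ^ n`, which is fixed by `σ`, is its square
  have hnorm : unitsInclusion K L (Units.map (RingOfIntegers.norm K) (x ^ n)) = (x ^ n) ^ 2 := by
    apply Units.ext
    apply RingOfIntegers.ext
    have hN : algebraMap K L (Algebra.norm K ((x ^ n : (𝓞 L)ˣ) : L)) =
        ((x ^ n : (𝓞 L)ˣ) : L) ^ 2 := by
      rw [← hk, Algebra.norm_algebraMap, h2, map_pow]
    exact hN
  obtain ⟨m, hm⟩ := exists_unitLog_unitsInclusion_eq (L := L) i h1
    (Units.map (RingOfIntegers.norm K) (x ^ n))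
  rw [hnorm, ← pow_mul, unitLog_pow] at hm
  set U := unitLog L (Additive.ofMul (unitsInclusion K L (fundSystem K i)))
  set X := unitLog L (Additive.ofMul x)
  have hgram : gram U (((n * 2 : ℕ) : ℝ) • X) = ((n * 2 : ℕ) : ℝ) ^ 2 * gram U X := by
    have := gram_smul_add_smul U X 1 0 0 ((n * 2 : ℕ) : ℝ)
    simpa using this
  have hzero : gram U ((m : ℝ) • U) = 0 := by
    have := gram_smul_add_smul U U 1 0 m 0
    simpa using this
  rw [hm, hzero] at hgram
  have : (0 : ℝ) < ((n * 2 : ℕ) : ℝ) ^ 2 * gram U X := by positivity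
  linarith

end Quadratic

/-! ### Bounds over a fixed real quadratic field -/

section Main

variable {K : Type u} {L : Type v} [Field K] [NumberField K] [Field L] [NumberField L]

theorem rank_eq_one_of_isTotallyReal (hdeg : Module.finrank ℚ K = 2) (hreal : IsTotallyReal K) :
    rank K = 1 := by
  have h := card_eq_nrRealPlaces_add_nrComplexPlaces K
  rw [IsTotallyReal.nrComplexPlaces_eq_zero, ← IsTotallyReal.finrank, hdeg] at h
  rw [rank, h]

theorem IsD4Quartic.card_infinitePlace (hL : IsD4Quartic L) :
    Fintype.card (InfinitePlace L) = 3 := by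
  rw [card_eq_nrRealPlaces_add_nrComplexPlaces L, hL.nrRealPlaces_eq, hL.nrComplexPlaces_eq]

variable [Algebra K L]

theorem IsD4Quartic.finrank_quadratic (hL : IsD4Quartic L) (hdeg : Module.finrank ℚ K = 2) :
    Module.finrank K L = 2 := by
  have h := Module.finrank_mul_finrank ℚ K L
  rw [hdeg, hL.finrank_eq] at h
  omega

theorem norm_unitLog_unitsInclusion_le (hL : IsD4Quartic L) (y : (𝓞 K)ˣ) :
    ‖unitLog L (Additive.ofMul (unitsInclusion K L y))‖ ≤
      4 * ∑ v : InfinitePlace K, |Real.log (v (y : K))| := by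
  set M := ∑ v : InfinitePlace K, |Real.log (v (y : K))|
  have hM : 0 ≤ M := Finset.sum_nonneg fun _ _ => abs_nonneg _
  have hcoord : ∀ w : InfinitePlace L,
      ‖(unitLog L (Additive.ofMul (unitsInclusion K L y))) w‖ ^ 2 ≤ (2 * M) ^ 2 := by
    intro w
    have h1 : |Real.log (w (algebraMap K L (y : K)))| ≤ M :=
      Finset.single_le_sum (f := fun v : InfinitePlace K => |Real.log (v (y : K))|)
        (fun _ _ => abs_nonneg _) (Finset.mem_univ (w.comap (algebraMap K L)))
    have h2 : (mult w : ℝ) ≤ 2 := by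
      unfold mult
      split_ifs <;> norm_num
    refine pow_le_pow_left₀ (norm_nonneg _) ?_ 2
    rw [show (unitLog L (Additive.ofMul (unitsInclusion K L y))) w =
      (mult w : ℝ) * Real.log (w (algebraMap K L (y : K))) from rfl, Real.norm_eq_abs, abs_mul,
      Nat.abs_cast]
    exact mul_le_mul h2 h1 (abs_nonneg _) two_pos.le
  have hsq : ‖unitLog L (Additive.ofMul (unitsInclusion K L y))‖ ^ 2 ≤ (4 * M) ^ 2 := by
    rw [EuclideanSpace.norm_sq_eq]
    refine (Finset.sum_le_sum fun w _ => hcoord w).trans ?_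
    rw [Finset.sum_const, Finset.card_univ, hL.card_infinitePlace, nsmul_eq_mul]
    push_cast
    nlinarith [sq_nonneg M]
  exact le_of_sq_le_sq hsq (by positivity)

variable (K) in
/-- The logarithm of the relative discriminant is bounded by a linear function of the height of the
unit shape. -/
theorem exists_log_absNorm_relDiscr_le (hdeg : Module.finrank ℚ K = 2) (h1 : rank K = 1) :
    ∃ C : ℝ, 0 ≤ C ∧ ∀ (L : Type v) [Field L] [NumberField L] [Algebra K L]
      (hL : IsD4Quartic L), Real.log (Ideal.absNorm (relDiscr K L)) ≤
        4 * Real.log 2 + C * (representative (unitShape L hL.rank_eq)).im := by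
  obtain ⟨i⟩ : Nonempty (Fin (rank K)) := by rw [h1]; infer_instance
  set ε := fundSystem K i
  set M := ∑ v : InfinitePlace K, |Real.log (v (ε : K))|
  have hM : 0 ≤ M := Finset.sum_nonneg fun _ _ => abs_nonneg _
  refine ⟨3 * (2 * (4 * M)), by positivity, ?_⟩
  intro L _ _ _ hL
  have h2 := hL.finrank_quadratic hdeg
  have hε : ε ∉ torsion K := by
    intro h
    have h3 := fundSystem_mk K i
    rw [(QuotientGroup.eq_one_iff _).mpr h] at h3
    exact (basisModTorsion K).ne_zero i h3.symm
  have hu : unitsInclusion K L ε ∉ torsion L := fun h => hε (unitsInclusion_mem_torsion_iff.mp h)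
  obtain ⟨x, hpos, hle⟩ := exists_unit_sqrt_gram_le L hL.rank_eq hu
  obtain ⟨σ, hσσ, hσ⟩ := exists_conj_of_finrank_eq_two h2
  set x' := unitsEquiv σ.toRingEquiv x with hx'
  have hfix : unitsEquiv σ.toRingEquiv (unitsInclusion K L ε) = unitsInclusion K L ε := by
    apply Units.ext
    apply RingOfIntegers.ext
    exact σ.commutes _
  have hη : x / x' ∉ torsion L := div_conj_notMem_torsion h2 h1 i hσ hpos
  have hση : σ ((x / x' : (𝓞 L)ˣ) : L) = (((x / x')⁻¹ : (𝓞 L)ˣ) : L) := by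
    have hx2 : unitsEquiv σ.toRingEquiv x' = x := by
      apply Units.ext
      apply RingOfIntegers.ext
      exact hσσ _
    have h3 : unitsEquiv σ.toRingEquiv (x / x') = (x / x')⁻¹ := by
      rw [map_div, hx2, ← hx', inv_div]
    exact congrArg (fun z : (𝓞 L)ˣ => (z : L)) h3
  have hdisc := log_absNorm_relDiscr_le h2 σ hση hη
  rw [hL.finrank_eq, hL.card_infinitePlace, ofMul_div, map_sub] at hdisc
  push_cast at hdisc
  have hnorm := norm_mul_norm_sub_le_two_mul_sqrt_gram
    (w := unitLog L (Additive.ofMul (unitsInclusion K L ε)))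
    (norm_unitLog_unitsEquiv σ.toRingEquiv x)
    (by simpa only [hfix] using inner_unitLog_unitsEquiv σ.toRingEquiv (unitsInclusion K L ε) x)
  have hbound := norm_unitLog_unitsInclusion_le hL ε
  have hy := (representative (unitShape L hL.rank_eq)).im_pos
  set y := (representative (unitShape L hL.rank_eq)).im
  set U := unitLog L (Additive.ofMul (unitsInclusion K L ε))
  have hU : 0 < ‖U‖ := by
    refine (norm_nonneg _).lt_of_ne' fun h0 => ?_
    rw [norm_eq_zero.mp h0] at hpos
    simp [gram] at hpos
  have hdist : ‖unitLog L (Additive.ofMul x) - unitLog L (Additive.ofMul x')‖ ≤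
      2 * (4 * M) * y := by
    have h3 : ‖U‖ * ‖unitLog L (Additive.ofMul x) - unitLog L (Additive.ofMul x')‖ ≤
        ‖U‖ * (2 * ‖U‖ * y) := by nlinarith
    refine (le_of_mul_le_mul_left h3 hU).trans ?_
    gcongr
  linarith

end Main

end UnitShape

end

theorem mainTheorem3 (K : Type u) [Field K] [NumberField K]
    (hdeg : Module.finrank ℚ K = 2) (hreal : NumberField.IsTotallyReal K) :
    derivedSet (UnitShape.unitShapes.{u, v} K) = ∅ ∧
    (∃ c : ℝ, 0 < c ∧
      ∀ (L : Type v) [Field L] [NumberField L] [Algebra K L] (hL : UnitShape.IsD4Quartic L),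
        c * √(Real.log (Ideal.absNorm (UnitShape.relDiscr K L))) ≤
          (UnitShape.representative (UnitShape.unitShape L hL.rank_eq)).im) ∧
    (∀ B : ℝ, ∃ S : Set (IntermediateField ℚ (AlgebraicClosure ℚ)), S.Finite ∧
      ∀ (L : Type v) [Field L] [NumberField L] [Algebra K L], UnitShape.IsD4Quartic L →
        √(Real.log (Ideal.absNorm (UnitShape.relDiscr K L))) ≤ B →
          ∃ F ∈ S, Nonempty (L ≃+* F)) := by
  obtain ⟨C, hC, hbound⟩ := UnitShape.exists_log_absNorm_relDiscr_le.{u, v} K hdeg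
    (UnitShape.rank_eq_one_of_isTotallyReal hdeg hreal)
  have hheight : ∃ c : ℝ, 0 < c ∧
      ∀ (L : Type v) [Field L] [NumberField L] [Algebra K L] (hL : UnitShape.IsD4Quartic L),
        c * √(Real.log (Ideal.absNorm (UnitShape.relDiscr K L))) ≤
          (UnitShape.representative (UnitShape.unitShape L hL.rank_eq)).im := by
    have hlog : 0 < Real.log 2 := Real.log_pos one_lt_two
    -- since `y ≥ 1 / 2`, the linear bound `4 log 2 + C y` is at most `(16 log 2 + 2 C) y²`
    have hD : 0 < 16 * Real.log 2 + 2 * C := by positivity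
    refine ⟨(√(16 * Real.log 2 + 2 * C))⁻¹, by positivity, ?_⟩
    intro L _ _ _ hL
    have hle := hbound L hL
    have hhalf := UnitShape.half_le_im_of_mem_fundamentalDomain
      (UnitShape.representative_mem (UnitShape.unitShape L hL.rank_eq))
    set y := (UnitShape.representative (UnitShape.unitShape L hL.rank_eq)).im
    rw [inv_mul_le_iff₀ (by positivity)]
    refine Real.sqrt_le_iff.mpr ⟨by positivity, hle.trans ?_⟩
    rw [mul_pow, Real.sq_sqrt hD.le]
    have h1 : 1 ≤ 4 * y ^ 2 := by nlinarith
    have h2 : y ≤ 2 * y ^ 2 := by nlinarith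
    nlinarith
  have hfinite : ∀ B : ℝ, ∃ S : Set (IntermediateField ℚ (AlgebraicClosure ℚ)), S.Finite ∧
      ∀ (L : Type v) [Field L] [NumberField L] [Algebra K L], UnitShape.IsD4Quartic L →
        √(Real.log (Ideal.absNorm (UnitShape.relDiscr K L))) ≤ B →
          ∃ F ∈ S, Nonempty (L ≃+* F) := by
    intro B
    obtain ⟨S, hS, h⟩ := UnitShape.exists_finite_of_absNorm_relDiscr_le.{u, v} K 2
      ⌈Real.exp (B ^ 2)⌉₊
    refine ⟨S, hS, fun L _ _ _ hL hB => h L (hL.finrank_quadratic hdeg).le ?_⟩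
    have hlog := (Real.sqrt_le_iff.mp hB).2
    have hexp : (Ideal.absNorm (UnitShape.relDiscr K L) : ℝ) ≤ Real.exp (B ^ 2) :=
      (Real.le_exp_log _).trans (Real.exp_le_exp.mpr hlog)
    exact_mod_cast hexp.trans (Nat.le_ceil _)
  refine ⟨UnitShape.derivedSet_eq_empty_of_finite fun M => ?_, hheight, hfinite⟩
  obtain ⟨c, hc, hc'⟩ := hheight
  obtain ⟨S, hS, hSL⟩ := hfinite (M / c)
  -- shapes of bounded height come from finitely many fields, and isomorphic fields share a shape
  have hcover : {p ∈ UnitShape.unitShapes.{u, v} K | (UnitShape.representative p).im ≤ M} ⊆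
      ⋃ F ∈ S, {p | ∃ (_ : NumberField F) (h : rank F = 2), p = UnitShape.unitShape F h} := by
    rintro _ ⟨⟨L, _, _, hL, ⟨f⟩, rfl⟩, hM⟩
    let _ : Algebra K L := f.toAlgebra
    obtain ⟨F, hF, ⟨e⟩⟩ := hSL L hL (by
      rw [le_div_iff₀' hc]
      exact (hc' L hL).trans hM)
    have hnf : NumberField F :=
      { to_finiteDimensional :=
          Module.Finite.of_surjective (e : L →+ F).toRatLinearMap e.surjective }
    have hrank : rank F = 2 := by
      rw [rank, Fintype.card_congr (UnitShape.placeEquiv e), hL.card_infinitePlace]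
    exact Set.mem_biUnion hF ⟨hnf, hrank, (UnitShape.unitShape_congr e hL.rank_eq hrank).symm⟩
  refine (hS.biUnion fun F _ => Set.Subsingleton.finite ?_).subset hcover
  rintro _ ⟨_, _, rfl⟩ _ ⟨_, _, rfl⟩
  rfl
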